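/- Let $\mathbb D$ be the open unit disk, $\mathbb T$ the unit circle, $m$ normalized Lebesgue measure on $\mathbb T$, and $H^2$ the Hardy space of $\mathbb D$, viewed through boundary functions as a closed subspace of $L^2(\mathbb T,m)$. An inner function is a holomorphic $u:\mathbb D\to\overline{\mathbb D}$ with radial limits of modulus one $m$-almost everywhere. For inner $u$ let $\mathcal K_u=H^2\cap(uH^2)^\perp$, and for inner $u,v$ let $$\mathscr M(u,v)=\{\varphi\in\operatorname{Hol}(\mathbb D):\ \varphi f\in\mathcal K_v \text{ for all } f\in\mathcal K_u\}.$$ For an inner function $u\not\equiv 1$, its Clark measure $\sigma_u$ is the unique finite positive Borel measure on $\mathbb T$ with $$\frac{1-|u(z)|^2}{|1-u(z)|^2}=\int_{\mathbb T}\frac{1-|z|^2}{|z-\xi|^2}\,d\sigma_u(\xi),\qquad z\in\mathbb D.$$ For $\lambda\in\mathbb D$ put $k_\lambda(\xi)=(1-\overline\lambda\,\xi)^{-1}$. Theorem. Let $u,v$ be inner functions, neither identically equal to $1$, with Clark measures $\sigma_u,\sigma_v$, and let $\varphi\in H^2$. The following are equivalent: (i) $\varphi\in\mathscr M(u,v)$;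 (ii) there exists a bounded linear operator $\mathfrak L_\varphi:L^2(\sigma_v)\to L^2(\sigma_u)$ such that $$\mathfrak L_\varphi(k_\lambda)=\overline{\varphi(\lambda)}\,\frac{1-\overline{u(\lambda)}}{1-\overline{v(\lambda)}}\,k_\lambda,\qquad \lambda\in\mathbb D.$$ -/

import Mathlib

open MeasureTheory Filter Topology

noncomputable section

namespace ModelSpace

/-- The open unit disk. Functions on the disk are represented by functions `ℂ → ℂ`;
their values outside the disk are irrelevant to every notion below. -/
abbrev disk : Set ℂ := Metric.ball (0 : ℂ) 1

instance instMeasurableSpaceCircle : MeasurableSpace Circle := borel Circle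

instance instBorelSpaceCircle : BorelSpace Circle := ⟨rfl⟩

/-- Normalized Lebesgue measure `dθ / (2π)` on the unit circle. -/
def m : Measure Circle :=
  (ENNReal.ofReal (2 * Real.pi))⁻¹ •
    (volume.restrict (Set.Ioc (0 : ℝ) (2 * Real.pi))).map Circle.exp

/-- The Hardy space `H²`: holomorphic functions on the disk with bounded square means. -/
def H2 : Set (ℂ → ℂ) :=
  {f | DifferentiableOn ℂ f disk ∧
    ∃ C : ℝ, ∀ r : ℝ, 0 ≤ r → r < 1 → ∫ ξ : Circle, ‖f (r * ξ)‖ ^ 2 ∂m ≤ C}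

/-- `F ∈ L²(m)` is the boundary function of `f`: the dilates `ξ ↦ f (r ξ)` converge to `F`
in `L²(m)` as `r → 1⁻`. Every `f ∈ H²` has exactly one boundary function. -/
def IsBoundaryFunction (f : ℂ → ℂ) (F : Lp ℂ 2 m) : Prop :=
  Tendsto (fun r : ℝ => ∫ ξ : Circle, ‖f (r * ξ) - F ξ‖ ^ 2 ∂m) (𝓝[<] 1) (𝓝 0)

/-- Inner functions: holomorphic on the disk, bounded by one, with radial limits of modulus one
at almost every point of the circle. -/
structure IsInner (u : ℂ → ℂ) : Prop where
  differentiableOn : DifferentiableOn ℂ u disk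
  norm_le_one : ∀ z ∈ disk, ‖u z‖ ≤ 1
  radial_limit : ∀ᵐ ξ : Circle ∂m,
    ∃ w : ℂ, ‖w‖ = 1 ∧ Tendsto (fun r : ℝ => u (r * ξ)) (𝓝[<] 1) (𝓝 w)

/-- The model space `K_u = H² ∩ (u H²)^⊥`, with orthogonality of boundary functions
in `L²(m)`. -/
def modelSpace (u : ℂ → ℂ) : Set (ℂ → ℂ) :=
  {f | f ∈ H2 ∧ ∃ F : Lp ℂ 2 m, IsBoundaryFunction f F ∧
    ∀ h ∈ H2, ∀ G : Lp ℂ 2 m, IsBoundaryFunction (fun z => u z * h z) G → inner ℂ G F = 0}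

/-- The multipliers from `K_u` to `K_v`. -/
def multipliers (u v : ℂ → ℂ) : Set (ℂ → ℂ) :=
  {φ | DifferentiableOn ℂ φ disk ∧
    ∀ f ∈ modelSpace u, (fun z => φ z * f z) ∈ modelSpace v}

/-- The defining property of the Clark measure of `u`: a finite positive measure on the circle
whose Poisson integral is `(1 - |u|²) / |1 - u|²`. -/
def IsClarkMeasure (u : ℂ → ℂ) (σ : Measure Circle) : Prop :=
  IsFiniteMeasure σ ∧ ∀ z ∈ disk,
    (1 - ‖u z‖ ^ 2) / ‖1 - u z‖ ^ 2 = ∫ ξ : Circle, (1 - ‖z‖ ^ 2) / ‖z - ξ‖ ^ 2 ∂σ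

open Classical in
/-- The Clark measure of `u`. It exists and is unique for every inner `u` that is not identically
one; the value `0` is used where no measure has the defining property. -/
def clarkMeasure (u : ℂ → ℂ) : Measure Circle :=
  if h : ∃ σ : Measure Circle, IsClarkMeasure u σ then h.choose else 0

instance isFiniteMeasure_clarkMeasure (u : ℂ → ℂ) : IsFiniteMeasure (clarkMeasure u) := by
  unfold clarkMeasure
  split_ifs with h
  · exact h.choose_spec.1
  · infer_instance

/-- The Cauchy kernel `k_l (ξ) = 1 / (1 - conj l * ξ)`, `|l| < 1`, as a continuous function on
the circle. -/
def cauchyKernel (l : Complex.UnitDisc) : C(Circle, ℂ) where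
  toFun ξ := (1 - star (l : ℂ) * (ξ : ℂ))⁻¹
  continuous_toFun := by
    refine Continuous.inv₀ (by fun_prop) fun ξ h => ?_
    have h1 : star (l : ℂ) * (ξ : ℂ) = 1 := (sub_eq_zero.mp h).symm
    have h2 := congrArg norm h1
    rw [norm_mul, norm_star, Circle.norm_coe, mul_one, norm_one] at h2
    exact l.norm_lt_one.ne h2

/-- The Cauchy kernel as an element of `L²(σ)`. -/
def cauchyKernelLp (σ : Measure Circle) [IsFiniteMeasure σ] (l : Complex.UnitDisc) : Lp ℂ 2 σ :=
  ContinuousMap.toLp 2 σ ℂ (cauchyKernel l)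

end ModelSpace

end

noncomputable section

namespace ModelSpace

/-! ### Bounded operators prescribed on a family of vectors -/

section Hilbert

variable {ι E F E' F' : Type*}
  [NormedAddCommGroup E] [InnerProductSpace ℂ E]
  [NormedAddCommGroup F] [InnerProductSpace ℂ F]
  [NormedAddCommGroup E'] [InnerProductSpace ℂ E']
  [NormedAddCommGroup F'] [InnerProductSpace ℂ F']

/-! Both conditions say that a bounded operator takes prescribed values on a family of kernels.
Write `K^u_l(z) = (1 - conj (u l) * u z) / (1 - conj l * z)` for the reproducing kernel of `K_u`. If
`φ` multiplies `K_u` into `K_v`, the closed graph theorem makes multiplication bounded, and its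
adjoint sends `K^v_l` to `conj (φ l) • K^u_l`. Conversely, the adjoint of any bounded operator
acting so on the kernels is multiplication by `φ` (`mem_multipliers_iff_exists_adjoint`).

Clark's isometry carries this to the measures: in `L²(σ_u)` the Cauchy kernels `k_l` have the same
Gram matrix as `K^u_l / (1 - conj (u l))` (`IsInner.inner_cauchyKernelLp`,
`IsInner.inner_kernel_kernel`). The normalizing factors for `u` and `v` produce the quotient in
(ii). Existence of a bounded operator with prescribed values depends only on Gram matrices
(`exists_clm_of_inner_eq`), so Clark's isometry is never constructed as an operator. -/

theorem exists_clm_of_norm_linearCombination_le [CompleteSpace E] [CompleteSpace F]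
    {a : ι → E} {b : ι → F} {C : ℝ}
    (h : ∀ c : ι →₀ ℂ,
      ‖Finsupp.linearCombination ℂ b c‖ ≤ C * ‖Finsupp.linearCombination ℂ a c‖) :
    ∃ L : E →L[ℂ] F, ∀ i, L (a i) = b i := by
  set A := Finsupp.linearCombination ℂ a
  let p : Submodule ℂ E := (LinearMap.range A).topologicalClosure
  have : CompleteSpace p := (Submodule.isClosed_topologicalClosure _).completeSpace_coe
  let e : (ι →₀ ℂ) →ₗ[ℂ] p :=
    A.codRestrict p fun c => Submodule.le_topologicalClosure _ (LinearMap.mem_range_self A c)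
  have he : DenseRange e := by
    intro x
    have hx : (x : E) ∈ closure (Set.range A) := x.2
    rw [closure_subtype, ← Set.range_comp]
    exact hx
  -- Composing with the projection extends by zero off the closed span, so the family need not be
  -- total.
  refine ⟨((Finsupp.linearCombination ℂ b).extendOfNorm e).comp p.orthogonalProjectionOnto,
    fun i => ?_⟩
  have hi : A (Finsupp.single i 1) = a i := by simp [A]
  have hp : p.orthogonalProjectionOnto (a i) = e (Finsupp.single i 1) := by
    rw [← hi]
    exact Submodule.orthogonalProjectionOnto_mem_subspace_eq_self (K := p) (e (Finsupp.single i 1))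
  rw [ContinuousLinearMap.comp_apply, hp, LinearMap.extendOfNorm_eq he ⟨C, h⟩]
  simp

theorem norm_linearCombination_eq_of_inner_eq {a : ι → E} {a' : ι → E'}
    (h : ∀ i j, inner ℂ (a i) (a j) = inner ℂ (a' i) (a' j)) (c : ι →₀ ℂ) :
    ‖Finsupp.linearCombination ℂ a c‖ = ‖Finsupp.linearCombination ℂ a' c‖ := by
  have : inner ℂ (Finsupp.linearCombination ℂ a c) (Finsupp.linearCombination ℂ a c) =
      inner ℂ (Finsupp.linearCombination ℂ a' c) (Finsupp.linearCombination ℂ a' c) := by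
    simp only [Finsupp.linearCombination_apply, Finsupp.sum, inner_sum, sum_inner,
      inner_smul_left, inner_smul_right, h]
  rw [@norm_eq_sqrt_re_inner ℂ, @norm_eq_sqrt_re_inner ℂ E', this]

/-- Whether a bounded operator with `a i ↦ b i` exists depends only on the Gram matrices. -/
theorem exists_clm_of_inner_eq [CompleteSpace E'] [CompleteSpace F']
    {a : ι → E} {a' : ι → E'} {b : ι → F}
    {b' : ι → F'}
    (ha : ∀ i j, inner ℂ (a i) (a j) = inner ℂ (a' i) (a' j))
    (hb : ∀ i j, inner ℂ (b i) (b j) = inner ℂ (b' i) (b' j))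
    (h : ∃ L : E →L[ℂ] F, ∀ i, L (a i) = b i) :
    ∃ L : E' →L[ℂ] F', ∀ i, L (a' i) = b' i := by
  obtain ⟨L, hL⟩ := h
  refine exists_clm_of_norm_linearCombination_le (C := ‖L‖) fun c => ?_
  rw [← norm_linearCombination_eq_of_inner_eq ha, ← norm_linearCombination_eq_of_inner_eq hb]
  have : Finsupp.linearCombination ℂ b c = L (Finsupp.linearCombination ℂ a c) := by
    simp [Finsupp.linearCombination_apply, Finsupp.sum, hL]
  rw [this]
  exact L.le_opNorm _

end Hilbert

/-! ### Normalized Lebesgue measure -/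

instance : IsProbabilityMeasure m := by
  constructor
  rw [m, Measure.smul_apply, Measure.map_apply Circle.exp.continuous.measurable MeasurableSet.univ]
  simp only [Set.preimage_univ, Measure.restrict_apply_univ, Real.volume_Ioc, sub_zero, smul_eq_mul]
  exact ENNReal.inv_mul_cancel (by simp [Real.pi_pos]) ENNReal.ofReal_ne_top

theorem integral_m {E : Type*} [NormedAddCommGroup E] [NormedSpace ℝ E] {g : Circle → E}
    (hg : Continuous g) :
    ∫ ξ, g ξ ∂m = (2 * Real.pi)⁻¹ • ∫ θ in (0 : ℝ)..2 * Real.pi, g (Circle.exp θ) := by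
  rw [m, integral_smul_measure, integral_map Circle.exp.continuous.aemeasurable
    hg.aestronglyMeasurable, intervalIntegral.integral_of_le (by positivity)]
  congr 1
  rw [ENNReal.toReal_inv, ENNReal.toReal_ofReal (by positivity)]

theorem integral_m_eq_circleAverage {E : Type*} [NormedAddCommGroup E] [NormedSpace ℝ E]
    {f : ℂ → E} (hf : Continuous fun ξ : Circle => f ξ) :
    ∫ ξ : Circle, f ξ ∂m = Real.circleAverage f 0 1 := by
  rw [integral_m hf, Real.circleAverage_def]
  simp [circleMap]

/-- The monomial `ξ ^ n` on the circle. -/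
def circleMonomial (n : ℕ) : C(Circle, ℂ) := ⟨fun ξ => (ξ : ℂ) ^ n, by fun_prop⟩

theorem orthonormal_circleMonomial :
    Orthonormal ℂ fun n => ContinuousMap.toLp 2 m ℂ (circleMonomial n) := by
  rw [orthonormal_iff_ite]
  intro i j
  rw [ContinuousMap.inner_toLp, integral_m (by fun_prop)]
  have : ∀ θ : ℝ, circleMonomial j (Circle.exp θ) *
      (starRingEnd ℂ) (circleMonomial i (Circle.exp θ)) =
      Complex.exp (((j : ℂ) - i) * Complex.I * θ) := by
    intro θ
    simp only [circleMonomial, ContinuousMap.coe_mk, Circle.coe_exp, ← Complex.exp_conj,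
      map_mul, Complex.conj_ofReal, Complex.conj_I, ← Complex.exp_nat_mul, ← Complex.exp_add,
      Complex.conj_natCast]
    congr 1
    ring
  simp only [this]
  split_ifs with hij
  · subst hij
    simp
    field_simp
  · have hc : ((j : ℂ) - i) * Complex.I ≠ 0 :=
      mul_ne_zero (sub_ne_zero.mpr (by exact_mod_cast Ne.symm hij)) Complex.I_ne_zero
    rw [integral_exp_mul_complex hc]
    have : Complex.exp (((j : ℂ) - i) * Complex.I * ((2 * Real.pi : ℝ) : ℂ)) = 1 := by
      rw [Complex.exp_eq_one_iff]
      exact ⟨(j : ℤ) - i, by push_cast; ring⟩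
    rw [this]
    simp

/-- Square-summable Taylor coefficients. -/
abbrev CoeffSpace := lp (fun _ : ℕ => ℂ) 2

/-- The boundary function with given Taylor coefficients. -/
def boundaryMap : CoeffSpace →ₗᵢ[ℂ] Lp ℂ 2 m :=
  orthonormal_circleMonomial.orthogonalFamily.linearIsometry

theorem hasSum_boundaryMap (a : CoeffSpace) :
    HasSum (fun n => a n • ContinuousMap.toLp 2 m ℂ (circleMonomial n)) (boundaryMap a) := by
  exact orthonormal_circleMonomial.orthogonalFamily.hasSum_linearIsometry a

theorem coeffSpace_norm_sq (a : CoeffSpace) : HasSum (fun n => ‖a n‖ ^ 2) (‖a‖ ^ 2) := by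
  have := lp.hasSum_norm (p := 2) (by norm_num) a
  simpa using this

theorem memℓp_two_of_summable_norm {b : ℕ → ℂ} (hb : Summable fun n => ‖b n‖) : Memℓp b 2 := by
  have h1 : Memℓp b 1 := memℓp_gen (by simpa using hb)
  exact h1.of_exponent_ge (by norm_num)

/-- With absolutely summable coefficients the series converges uniformly on the circle, so its `L²`
sum is represented by its pointwise sum. -/
theorem boundaryMap_ae_eq (b : CoeffSpace) (hb : Summable fun n => ‖b n‖) :
    boundaryMap b =ᵐ[m] fun ξ => ∑' n, b n * (ξ : ℂ) ^ n := by
  have hs : Summable fun n => b n • circleMonomial n := by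
    refine Summable.of_norm_bounded hb fun n => ?_
    rw [norm_smul]
    refine mul_le_of_le_one_right (norm_nonneg _) ?_
    rw [ContinuousMap.norm_le _ zero_le_one]
    intro ξ
    simp [circleMonomial, Circle.norm_coe]
  have h1 : boundaryMap b = ContinuousMap.toLp 2 m ℂ (∑' n, b n • circleMonomial n) := by
    refine (hasSum_boundaryMap b).unique ?_
    simpa using (ContinuousMap.toLp 2 m ℂ).hasSum hs.hasSum
  rw [h1]
  filter_upwards [ContinuousMap.coeFn_toLp (𝕜 := ℂ) (p := 2) m (∑' n, b n • circleMonomial n)]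
    with ξ hξ
  rw [hξ]
  exact ((ContinuousMap.hasSum_apply hs.hasSum ξ).tsum_eq).symm

theorem L2_norm_sq {μ : Measure Circle} (F : Lp ℂ 2 μ) : ‖F‖ ^ 2 = ∫ ξ, ‖F ξ‖ ^ 2 ∂μ := by
  have h : inner ℂ F F = ((∫ ξ, ‖F ξ‖ ^ 2 ∂μ : ℝ) : ℂ) := by
    rw [L2.inner_def, ← integral_complex_ofReal]
    refine integral_congr_ae (Eventually.of_forall fun ξ => ?_)
    simp only [inner_self_eq_norm_sq_to_K]
    norm_cast
  rw [inner_self_eq_norm_sq_to_K] at h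
  exact Complex.ofReal_injective (by rw [← h]; norm_cast)

/-! ### Dilates -/

theorem mul_mem_disk {r : ℝ} (h0 : 0 ≤ r) (h1 : r < 1) (ξ : Circle) : (r * ξ : ℂ) ∈ disk := by
  simpa [abs_of_nonneg h0, Circle.norm_coe] using h1

theorem eventually_mem_Ico : ∀ᶠ r : ℝ in 𝓝[<] 1, 0 ≤ r ∧ r < 1 := by
  filter_upwards [Ioo_mem_nhdsLT (show (0 : ℝ) < 1 by norm_num)] with r hr
  exact ⟨hr.1.le, hr.2⟩

theorem continuous_dilate {f : ℂ → ℂ} (hf : ContinuousOn f disk) {r : ℝ} (h0 : 0 ≤ r)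
    (h1 : r < 1) : Continuous fun ξ : Circle => f (r * ξ) :=
  hf.comp_continuous (by fun_prop) (mul_mem_disk h0 h1)

open Classical in
/-- The dilate `ξ ↦ f (r ξ)` as an element of `L²(m)`, zero if it is not continuous. -/
def dilate (f : ℂ → ℂ) (r : ℝ) : Lp ℂ 2 m :=
  if h : Continuous fun ξ : Circle => f (r * ξ) then
    ContinuousMap.toLp 2 m ℂ ⟨fun ξ => f (r * ξ), h⟩ else 0

section Dilate

variable {f g : ℂ → ℂ} {r : ℝ}

theorem dilate_ae_eq (hf : ContinuousOn f disk) (h0 : 0 ≤ r) (h1 : r < 1) :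
    dilate f r =ᵐ[m] fun ξ => f (r * ξ) := by
  rw [dilate, dif_pos (continuous_dilate hf h0 h1)]
  exact ContinuousMap.coeFn_toLp m _

theorem inner_dilate (hf : ContinuousOn f disk) (hg : ContinuousOn g disk) (h0 : 0 ≤ r)
    (h1 : r < 1) :
    inner ℂ (dilate f r) (dilate g r) = ∫ ξ : Circle, g (r * ξ) * star (f (r * ξ)) ∂m := by
  rw [dilate, dif_pos (continuous_dilate hf h0 h1), dilate, dif_pos (continuous_dilate hg h0 h1),
    ContinuousMap.inner_toLp]
  rfl

theorem norm_dilate_sub_sq (hf : ContinuousOn f disk) (h0 : 0 ≤ r) (h1 : r < 1)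
    (F : Lp ℂ 2 m) : ‖dilate f r - F‖ ^ 2 = ∫ ξ : Circle, ‖f (r * ξ) - F ξ‖ ^ 2 ∂m := by
  rw [L2_norm_sq]
  refine integral_congr_ae ?_
  filter_upwards [Lp.coeFn_sub (dilate f r) F, dilate_ae_eq hf h0 h1] with ξ h h'
  rw [h, Pi.sub_apply, h']

theorem norm_dilate_sq (hf : ContinuousOn f disk) (h0 : 0 ≤ r) (h1 : r < 1) :
    ‖dilate f r‖ ^ 2 = ∫ ξ : Circle, ‖f (r * ξ)‖ ^ 2 ∂m := by
  rw [L2_norm_sq]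
  refine integral_congr_ae ?_
  filter_upwards [dilate_ae_eq hf h0 h1] with ξ h'
  rw [h']

theorem isBoundaryFunction_iff (hf : ContinuousOn f disk) (F : Lp ℂ 2 m) :
    IsBoundaryFunction f F ↔ Tendsto (dilate f) (𝓝[<] 1) (𝓝 F) := by
  have h : (fun r : ℝ => ∫ ξ : Circle, ‖f (r * ξ) - F ξ‖ ^ 2 ∂m) =ᶠ[𝓝[<] 1]
      fun r => ‖dilate f r - F‖ ^ 2 := by
    filter_upwards [eventually_mem_Ico] with r hr
    rw [norm_dilate_sub_sq hf hr.1 hr.2]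
  rw [IsBoundaryFunction, tendsto_congr' h, tendsto_iff_norm_sub_tendsto_zero (f := dilate f)]
  refine ⟨fun h => ?_, fun h => ?_⟩
  · simpa only [Real.sqrt_sq (norm_nonneg _), Real.sqrt_zero] using h.sqrt
  · have := Tendsto.pow (M := ℝ) h 2
    simpa only [ne_eq, OfNat.ofNat_ne_zero, not_false_eq_true, zero_pow] using this

end Dilate

/-! ### The Hardy space through Taylor coefficients -/

/-- The holomorphic function on the disk with given Taylor coefficients. -/
def powerSum (a : CoeffSpace) (z : ℂ) : ℂ := ∑' n, a n * z ^ n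

theorem summable_norm_coeff_mul_pow (a : CoeffSpace) {r : ℝ} (h0 : 0 ≤ r) (h1 : r < 1) :
    Summable fun n => ‖a n‖ * r ^ n := by
  refine Summable.of_nonneg_of_le (fun n => by positivity) (fun n => ?_)
    ((summable_geometric_of_lt_one h0 h1).mul_left ‖a‖)
  gcongr
  exact lp.norm_apply_le_norm (by norm_num) a n

theorem hasSum_powerSum (a : CoeffSpace) {z : ℂ} (hz : z ∈ disk) :
    HasSum (fun n => a n * z ^ n) (powerSum a z) := by
  refine Summable.hasSum (Summable.of_norm ?_)
  simpa using summable_norm_coeff_mul_pow a (norm_nonneg z) (by simpa using hz)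

theorem differentiableOn_powerSum (a : CoeffSpace) : DifferentiableOn ℂ (powerSum a) disk := by
  intro z hz
  obtain ⟨r, hzr, hr⟩ := exists_between (show ‖z‖ < 1 by simpa using hz)
  have h0 : 0 ≤ r := (norm_nonneg z).trans hzr.le
  have : DifferentiableOn ℂ (fun w => ∑' n, a n * w ^ n) (Metric.ball 0 r) := by
    refine Complex.differentiableOn_tsum_of_summable_norm (summable_norm_coeff_mul_pow a h0 hr)
      (fun n => by fun_prop) Metric.isOpen_ball fun n w hw => ?_
    rw [norm_mul, norm_pow]
    gcongr
    exact (by simpa using hw : ‖w‖ < r).le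
  exact (this.differentiableAt (Metric.isOpen_ball.mem_nhds (by simpa using hzr)))
    |>.differentiableWithinAt

/-- The dilate of a power series has the damped coefficients. -/
theorem exists_coeff_dilate {c : ℕ → ℂ} {f : ℂ → ℂ} (hfc : ContinuousOn f disk)
    (hf : ∀ z ∈ disk, HasSum (fun n => c n * z ^ n) (f z)) {r : ℝ} (h0 : 0 ≤ r) (h1 : r < 1) :
    ∃ b : CoeffSpace, (∀ n, b n = c n * r ^ n) ∧ dilate f r = boundaryMap b := by
  have hr : (r : ℂ) ∈ disk := by simpa [abs_of_nonneg h0] using h1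
  have hs : Summable fun n => ‖c n * (r : ℂ) ^ n‖ := (hf r hr).summable.norm
  let b : CoeffSpace := ⟨fun n => c n * r ^ n, memℓp_two_of_summable_norm hs⟩
  refine ⟨b, fun n => rfl, Lp.ext ?_⟩
  filter_upwards [dilate_ae_eq hfc h0 h1, boundaryMap_ae_eq b hs] with ξ h h'
  rw [h, h', ← (hf _ (mul_mem_disk h0 h1 ξ)).tsum_eq]
  refine tsum_congr fun n => ?_
  simp only [b, mul_pow]
  ring

/-- By Parseval the squared distance is `∑ ‖a n‖² (1 - r ^ n)²`, which tends to zero by dominated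
convergence with majorant `‖a n‖²`. -/
theorem tendsto_dilate_powerSum (a : CoeffSpace) :
    Tendsto (dilate (powerSum a)) (𝓝[<] 1) (𝓝 (boundaryMap a)) := by
  have hc := (differentiableOn_powerSum a).continuousOn
  have key : ∀ r : ℝ, 0 ≤ r → r < 1 →
      ‖dilate (powerSum a) r - boundaryMap a‖ ^ 2 = ∑' n, ‖a n‖ ^ 2 * (1 - r ^ n) ^ 2 := by
    intro r h0 h1
    obtain ⟨b, hb, hd⟩ := exists_coeff_dilate hc (fun z hz => hasSum_powerSum a hz) h0 h1
    rw [hd, ← map_sub, LinearIsometry.norm_map, ← (coeffSpace_norm_sq _).tsum_eq]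
    refine tsum_congr fun n => ?_
    have : (b - a : CoeffSpace) n = -(a n * ((1 - r ^ n : ℝ) : ℂ)) := by
      rw [lp.coeFn_sub, Pi.sub_apply, hb]
      push_cast
      ring
    rw [this, norm_neg, norm_mul, mul_pow, Complex.norm_real, Real.norm_eq_abs, sq_abs]
  have lim : Tendsto (fun r : ℝ => ∑' n, ‖a n‖ ^ 2 * (1 - r ^ n) ^ 2) (𝓝[<] 1)
      (𝓝 (∑' _ : ℕ, (0 : ℝ))) := by
    refine tendsto_tsum_of_dominated_convergence (coeffSpace_norm_sq a).summable (fun n => ?_) ?_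
    · have : Continuous fun r : ℝ => ‖a n‖ ^ 2 * (1 - r ^ n) ^ 2 := by fun_prop
      simpa using (this.tendsto 1).mono_left nhdsWithin_le_nhds
    · filter_upwards [eventually_mem_Ico] with r hr n
      have h1 : 0 ≤ r ^ n := pow_nonneg hr.1 n
      have h2 : r ^ n ≤ 1 := pow_le_one₀ hr.1 hr.2.le
      rw [Real.norm_of_nonneg (by positivity)]
      exact mul_le_of_le_one_right (by positivity) (pow_le_one₀ (by linarith) (by linarith))
  rw [tendsto_iff_norm_sub_tendsto_zero]
  have := (lim.congr' (by
    filter_upwards [eventually_mem_Ico] with r hr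
    exact (key r hr.1 hr.2).symm)).sqrt
  simpa using this

theorem powerSum_mem_H2 (a : CoeffSpace) : powerSum a ∈ H2 := by
  refine ⟨differentiableOn_powerSum a, ‖a‖ ^ 2, fun r h0 h1 => ?_⟩
  have hc := (differentiableOn_powerSum a).continuousOn
  obtain ⟨b, hb, hd⟩ := exists_coeff_dilate hc (fun z hz => hasSum_powerSum a hz) h0 h1
  rw [← norm_dilate_sq hc h0 h1, hd, LinearIsometry.norm_map]
  refine hasSum_le (fun n => ?_) (coeffSpace_norm_sq b) (coeffSpace_norm_sq a)
  rw [hb, norm_mul, norm_pow, Complex.norm_real, Real.norm_of_nonneg h0]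
  gcongr
  exact mul_le_of_le_one_right (norm_nonneg _) (pow_le_one₀ h0 h1.le)

/-- Parseval on the circle of radius `r` bounds every finite sum of `‖c n‖² r ^ (2n)` by `C`;
letting `r → 1` in the finite sums gives square summability. -/
theorem exists_powerSum_of_mem_H2 {f : ℂ → ℂ} (hf : f ∈ H2) :
    ∃ a : CoeffSpace, ∀ z ∈ disk, f z = powerSum a z := by
  obtain ⟨hd, C, hC⟩ := hf
  let c : ℕ → ℂ := fun n => (n.factorial : ℂ)⁻¹ * iteratedDeriv n f 0
  have hs : ∀ z ∈ disk, HasSum (fun n => c n * z ^ n) (f z) := by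
    intro z hz
    convert! Complex.hasSum_taylorSeries_on_ball hd hz using 2 with n
    simp only [c, smul_eq_mul, sub_zero]
    ring
  have hbound : ∀ s : Finset ℕ, ∑ n ∈ s, ‖c n‖ ^ 2 ≤ C := by
    intro s
    have hcont : Continuous fun r : ℝ => ∑ n ∈ s, (‖c n‖ * r ^ n) ^ 2 := by fun_prop
    have hlim := (hcont.tendsto 1).mono_left (nhdsWithin_le_nhds (s := Set.Iio 1))
    simp only [one_pow, mul_one] at hlim
    refine le_of_tendsto hlim ?_
    filter_upwards [eventually_mem_Ico] with r ⟨h0, h1⟩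
    obtain ⟨b, hb, hdil⟩ := exists_coeff_dilate hd.continuousOn hs h0 h1
    refine le_trans ?_ (hC r h0 h1)
    rw [← norm_dilate_sq hd.continuousOn h0 h1, hdil, LinearIsometry.norm_map]
    refine le_trans (le_of_eq ?_)
      (sum_le_hasSum s (fun n _ => by positivity) (coeffSpace_norm_sq b))
    refine Finset.sum_congr rfl fun n _ => ?_
    rw [hb, norm_mul (c n), norm_pow, Complex.norm_real, Real.norm_of_nonneg h0]
  have hmem : Memℓp c 2 := by
    refine memℓp_gen ?_
    simpa using summable_of_sum_le (f := fun n => ‖c n‖ ^ 2) (fun n => by positivity) hbound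
  exact ⟨⟨c, hmem⟩, fun z hz => (hs z hz).tsum_eq.symm⟩

theorem dilate_congr {f g : ℂ → ℂ} (h : ∀ z ∈ disk, f z = g z) {r : ℝ} (h0 : 0 ≤ r)
    (h1 : r < 1) : dilate f r = dilate g r := by
  have : (fun ξ : Circle => f (r * ξ)) = fun ξ : Circle => g (r * ξ) :=
    funext fun ξ => h _ (mul_mem_disk h0 h1 ξ)
  unfold dilate
  congr!

theorem isBoundaryFunction_iff_eq {f : ℂ → ℂ} {a : CoeffSpace}
    (h : ∀ z ∈ disk, f z = powerSum a z) (F : Lp ℂ 2 m) :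
    IsBoundaryFunction f F ↔ F = boundaryMap a := by
  have hc : ContinuousOn f disk := (differentiableOn_powerSum a).continuousOn.congr h
  have ht : Tendsto (dilate f) (𝓝[<] 1) (𝓝 (boundaryMap a)) := by
    refine (tendsto_dilate_powerSum a).congr' ?_
    filter_upwards [eventually_mem_Ico] with r hr
    exact (dilate_congr h hr.1 hr.2).symm
  rw [isBoundaryFunction_iff hc]
  exact ⟨fun h' => tendsto_nhds_unique h' ht, fun h' => h' ▸ ht⟩

theorem eq_of_powerSum_eq {a b : CoeffSpace} (h : ∀ z ∈ disk, powerSum a z = powerSum b z) :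
    a = b :=
  boundaryMap.injective (((isBoundaryFunction_iff_eq h _).mp
    ((isBoundaryFunction_iff_eq (fun _ _ => rfl) _).mpr rfl)))

theorem H2_congr {f g : ℂ → ℂ} (hg : g ∈ H2) (h : ∀ z ∈ disk, f z = g z) : f ∈ H2 := by
  obtain ⟨hd, C, hC⟩ := hg
  refine ⟨hd.congr h, C, fun r h0 h1 => ?_⟩
  simpa only [h _ (mul_mem_disk h0 h1 _)] using hC r h0 h1

theorem mul_mem_H2 {u h : ℂ → ℂ} (hu : DifferentiableOn ℂ u disk) {M : ℝ}
    (hM : ∀ z ∈ disk, ‖u z‖ ≤ M) (hh : h ∈ H2) : (fun z => u z * h z) ∈ H2 := by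
  obtain ⟨hd, C, hC⟩ := hh
  refine ⟨hu.mul hd, M ^ 2 * C, fun r h0 h1 => ?_⟩
  refine le_trans ?_ (mul_le_mul_of_nonneg_left (hC r h0 h1) (sq_nonneg M))
  rw [← integral_const_mul]
  have hcu := continuous_dilate hu.continuousOn h0 h1
  have hch := continuous_dilate hd.continuousOn h0 h1
  have hint : ∀ {g : Circle → ℝ}, Continuous g → Integrable g m := fun {g} hg =>
    hg.integrable_of_hasCompactSupport (HasCompactSupport.of_compactSpace g)
  refine integral_mono (hint ((hcu.mul hch).norm.pow 2))
    (hint (continuous_const.mul (hch.norm.pow 2))) fun ξ => ?_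
  simp only [norm_mul, mul_pow]
  gcongr
  exact hM _ (mul_mem_disk h0 h1 ξ)

/-! ### Model spaces through Taylor coefficients -/

/-- The coefficients of the Cauchy kernel. -/
def szegoCoeff (l : Complex.UnitDisc) : CoeffSpace :=
  ⟨fun n => (star (l : ℂ)) ^ n, memℓp_two_of_summable_norm (by
    simpa using summable_geometric_of_lt_one (norm_nonneg (l : ℂ)) l.norm_lt_one)⟩

theorem coe_mem_disk (l : Complex.UnitDisc) : (l : ℂ) ∈ disk := by
  simpa using l.norm_lt_one

theorem inner_szegoCoeff (l : Complex.UnitDisc) (a : CoeffSpace) :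
    inner ℂ (szegoCoeff l) a = powerSum a l := by
  rw [lp.inner_eq_tsum, powerSum]
  refine tsum_congr fun n => ?_
  simp [szegoCoeff]

theorem norm_star_mul_lt_one (l : Complex.UnitDisc) {z : ℂ} (hz : z ∈ disk) :
    ‖star (l : ℂ) * z‖ < 1 := by
  rw [norm_mul, norm_star]
  exact mul_lt_one_of_nonneg_of_lt_one_left (norm_nonneg _) l.norm_lt_one
    (by simpa using hz : ‖z‖ < 1).le

theorem one_sub_star_mul_ne_zero (l : Complex.UnitDisc) {z : ℂ} (hz : z ∈ disk) :
    1 - star (l : ℂ) * z ≠ 0 := by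
  intro h
  have := norm_star_mul_lt_one l hz
  rw [← sub_eq_zero.mp h, norm_one] at this
  exact lt_irrefl _ this

theorem powerSum_szegoCoeff (l : Complex.UnitDisc) {z : ℂ} (hz : z ∈ disk) :
    powerSum (szegoCoeff l) z = (1 - star (l : ℂ) * z)⁻¹ := by
  rw [← tsum_geometric_of_norm_lt_one (norm_star_mul_lt_one l hz), powerSum]
  simp [szegoCoeff, mul_pow]

theorem norm_powerSum_szegoCoeff_le (l : Complex.UnitDisc) {z : ℂ} (hz : z ∈ disk) :
    ‖powerSum (szegoCoeff l) z‖ ≤ (1 - ‖(l : ℂ)‖)⁻¹ := by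
  rw [powerSum_szegoCoeff l hz, norm_inv]
  have h1 : 0 < 1 - ‖(l : ℂ)‖ := sub_pos.mpr l.norm_lt_one
  have h2 : ‖star (l : ℂ) * z‖ ≤ ‖(l : ℂ)‖ := by
    rw [norm_mul, norm_star]
    exact mul_le_of_le_one_right (norm_nonneg _) (by simpa using hz : ‖z‖ < 1).le
  have h3 := norm_sub_norm_le (1 : ℂ) (star (l : ℂ) * z)
  rw [norm_one] at h3
  exact inv_anti₀ h1 (by linarith)

/-- The model space of `u` as a closed subspace of the space of Taylor coefficients. -/
def modelSubmodule (u : ℂ → ℂ) : Submodule ℂ CoeffSpace :=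
  Submodule.comap boundaryMap.toLinearMap
    (Submodule.span ℂ {G : Lp ℂ 2 m | ∃ h ∈ H2, IsBoundaryFunction (fun z => u z * h z) G})ᗮ

/-- Orthogonality to a set and to its span agree, so there is no need to check that the boundary
functions of `u H²` form a subspace. -/
theorem mem_modelSubmodule {u : ℂ → ℂ} {a : CoeffSpace} :
    a ∈ modelSubmodule u ↔ ∀ h ∈ H2, ∀ G : Lp ℂ 2 m,
      IsBoundaryFunction (fun z => u z * h z) G → inner ℂ G (boundaryMap a) = 0 := by
  rw [modelSubmodule, Submodule.mem_comap, Submodule.mem_orthogonal]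
  constructor
  · intro H h hh G hG
    exact H G (Submodule.subset_span ⟨h, hh, hG⟩)
  · intro H G hG
    induction hG using Submodule.span_induction with
    | mem G hG =>
      obtain ⟨h, hh, hG⟩ := hG
      exact H h hh G hG
    | zero => simp
    | add x y _ _ hx hy => rw [inner_add_left, hx, hy, add_zero]
    | smul c x _ hx => rw [inner_smul_left, hx, mul_zero]

/-- Completeness is what the closed graph theorem and Hilbert space adjoints require. -/
instance (u : ℂ → ℂ) : CompleteSpace (modelSubmodule u) := by
  have h : IsClosed (modelSubmodule u : Set CoeffSpace) :=
    (Submodule.isClosed_orthogonal _).preimage boundaryMap.continuous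
  exact h.completeSpace_coe

theorem mem_modelSpace_iff {u f : ℂ → ℂ} :
    f ∈ modelSpace u ↔ ∃ a ∈ modelSubmodule u, ∀ z ∈ disk, f z = powerSum a z := by
  constructor
  · rintro ⟨hf, F, hF, H⟩
    obtain ⟨a, ha⟩ := exists_powerSum_of_mem_H2 hf
    rw [isBoundaryFunction_iff_eq ha] at hF
    subst hF
    exact ⟨a, mem_modelSubmodule.mpr H, ha⟩
  · rintro ⟨a, ha, h⟩
    exact ⟨H2_congr (powerSum_mem_H2 a) h, boundaryMap a, (isBoundaryFunction_iff_eq h _).mpr rfl,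
      mem_modelSubmodule.mp ha⟩

section Inner

variable {u : ℂ → ℂ}

theorem IsInner.mul_mem_H2 (hu : IsInner u) {h : ℂ → ℂ} (hh : h ∈ H2) :
    (fun z => u z * h z) ∈ H2 :=
  ModelSpace.mul_mem_H2 hu.differentiableOn hu.norm_le_one hh

/-- Multiplication by `1 - |u|²` kills bounded functions at the boundary. -/
theorem IsInner.tendsto_dilate_defect (hu : IsInner u) {k : ℂ → ℂ} (hk : ContinuousOn k disk)
    {M : ℝ} (hM : ∀ z ∈ disk, ‖k z‖ ≤ M) :
    Tendsto (dilate fun z => (1 - ‖u z‖ ^ 2 : ℝ) * k z) (𝓝[<] 1) (𝓝 0) := by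
  have huc := hu.differentiableOn.continuousOn
  have hg : ContinuousOn (fun z => ((1 - ‖u z‖ ^ 2 : ℝ) : ℂ) * k z) disk :=
    (Complex.continuous_ofReal.comp_continuousOn
      (continuousOn_const.sub (huc.norm.pow 2))).mul hk
  rw [← isBoundaryFunction_iff hg, IsBoundaryFunction]
  have h0 : ∀ᵐ ξ ∂m, (0 : Lp ℂ 2 m) ξ = 0 := Lp.coeFn_zero ℂ 2 m
  have hlim : Tendsto (fun r : ℝ => ∫ ξ : Circle,
      ‖((1 - ‖u (r * ξ)‖ ^ 2 : ℝ) : ℂ) * k (r * ξ) - (0 : Lp ℂ 2 m) ξ‖ ^ 2 ∂m) (𝓝[<] 1)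
      (𝓝 (∫ _ : Circle, (0 : ℝ) ∂m)) := by
    -- Since `0 ≤ 1 - |u|² ≤ 1`, the integrand is at most `M ^ 2`; it tends to zero wherever `u` has
    -- a radial limit of modulus one.
    refine tendsto_integral_filter_of_dominated_convergence (fun _ => M ^ 2) ?_ ?_
      (integrable_const _) ?_
    · filter_upwards [eventually_mem_Ico] with r hr
      exact (((continuous_dilate hg hr.1 hr.2).aestronglyMeasurable.sub
        (Lp.aestronglyMeasurable _)).norm.pow 2)
    · filter_upwards [eventually_mem_Ico] with r hr
      filter_upwards [h0] with ξ hξ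
      have hz := mul_mem_disk hr.1 hr.2 ξ
      have h1 := hu.norm_le_one _ hz
      rw [hξ, sub_zero, norm_pow, norm_norm, norm_mul, Complex.norm_real, Real.norm_eq_abs]
      refine pow_le_pow_left₀ (by positivity) ?_ 2
      refine (mul_le_of_le_one_left (norm_nonneg _) ?_).trans (hM _ hz)
      rw [abs_le]
      constructor <;> nlinarith [norm_nonneg (u (r * ξ))]
    · filter_upwards [h0, hu.radial_limit] with ξ hξ ⟨w, hw, hlim⟩
      have h1 : Tendsto (fun r : ℝ => (1 - ‖u (r * ξ)‖ ^ 2) ^ 2 * M ^ 2) (𝓝[<] 1) (𝓝 0) := by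
        simpa [hw] using (((hlim.norm.pow 2).const_sub 1).pow 2).mul_const (M ^ 2)
      refine squeeze_zero' (Eventually.of_forall fun r => by positivity) ?_ h1
      filter_upwards [eventually_mem_Ico] with r hr
      rw [hξ, sub_zero, norm_mul, mul_pow, Complex.norm_real, Real.norm_eq_abs, sq_abs]
      gcongr
      exact hM _ (mul_mem_disk hr.1 hr.2 ξ)
  simpa using hlim

/-- Multiplication by an inner function preserves inner products. -/
theorem IsInner.inner_of_eq_mul (hu : IsInner u) {a b c d : CoeffSpace}
    (ha : ∀ z ∈ disk, powerSum a z = u z * powerSum c z)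
    (hb : ∀ z ∈ disk, powerSum b z = u z * powerSum d z)
    {M : ℝ} (hM : ∀ z ∈ disk, ‖powerSum d z‖ ≤ M) :
    inner ℂ a b = inner ℂ c d := by
  have hc : ∀ a : CoeffSpace, ContinuousOn (powerSum a) disk :=
    fun a => (differentiableOn_powerSum a).continuousOn
  have huc := hu.differentiableOn.continuousOn
  have hg : ContinuousOn (fun z => ((1 - ‖u z‖ ^ 2 : ℝ) : ℂ) * powerSum d z) disk :=
    (Complex.continuous_ofReal.comp_continuousOn
      (continuousOn_const.sub (huc.norm.pow 2))).mul (hc d)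
  have h1 : Tendsto (fun r => inner ℂ (dilate (powerSum c) r) (dilate (powerSum d) r) -
      inner ℂ (dilate (powerSum a) r) (dilate (powerSum b) r)) (𝓝[<] 1)
      (𝓝 (inner ℂ c d - inner ℂ a b)) := by
    rw [← boundaryMap.inner_map_map c d, ← boundaryMap.inner_map_map a b]
    exact ((tendsto_dilate_powerSum c).inner (tendsto_dilate_powerSum d)).sub
      ((tendsto_dilate_powerSum a).inner (tendsto_dilate_powerSum b))
  -- On each circle of radius `r < 1`, `⟨c, d⟩ - ⟨u c, u d⟩ = ⟨c, (1 - |u|²) d⟩`, so only `d` has to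
  -- be bounded.
  have h2 := (tendsto_dilate_powerSum c).inner (𝕜 := ℂ) (hu.tendsto_dilate_defect (hc d) hM)
  rw [inner_zero_right] at h2
  have h3 : Tendsto (fun r => inner ℂ (dilate (powerSum c) r) (dilate (powerSum d) r) -
      inner ℂ (dilate (powerSum a) r) (dilate (powerSum b) r)) (𝓝[<] 1) (𝓝 0) := by
    refine h2.congr' ?_
    filter_upwards [eventually_mem_Ico] with r ⟨hr0, hr1⟩
    have hint : ∀ {g : Circle → ℂ}, Continuous g → Integrable g m := fun {g} hg =>
      hg.integrable_of_hasCompactSupport (HasCompactSupport.of_compactSpace g)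
    rw [inner_dilate (hc c) hg hr0 hr1, inner_dilate (hc c) (hc d) hr0 hr1,
      inner_dilate (hc a) (hc b) hr0 hr1, ← integral_sub]
    · refine integral_congr_ae (Eventually.of_forall fun ξ => ?_)
      have hz := mul_mem_disk hr0 hr1 ξ
      simp only [ha _ hz, hb _ hz, star_mul', Complex.ofReal_sub, Complex.ofReal_one,
        Complex.ofReal_pow]
      rw [← Complex.mul_conj' (u (r * ξ))]
      simp only [starRingEnd_apply]
      ring
    · exact hint ((continuous_dilate (hc d) hr0 hr1).mul (continuous_dilate (hc c) hr0 hr1).star)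
    · exact hint ((continuous_dilate (hc b) hr0 hr1).mul (continuous_dilate (hc a) hr0 hr1).star)
  exact (sub_eq_zero.mp (tendsto_nhds_unique h1 h3)).symm

/-- The reproducing kernel of the model space. -/
theorem IsInner.exists_kernel (hu : IsInner u) (l : Complex.UnitDisc) :
    ∃ K : modelSubmodule u,
      (∀ z ∈ disk, powerSum (K : CoeffSpace) z =
        (1 - star (u l) * u z) / (1 - star (l : ℂ) * z)) ∧
      ∀ a : modelSubmodule u, inner ℂ K a = powerSum (a : CoeffSpace) l := by
  have hkH := powerSum_mem_H2 (szegoCoeff l)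
  obtain ⟨b, hb⟩ := exists_powerSum_of_mem_H2 (hu.mul_mem_H2 hkH)
  have hbB : IsBoundaryFunction (fun z => u z * powerSum (szegoCoeff l) z) (boundaryMap b) :=
    (isBoundaryFunction_iff_eq hb _).mpr rfl
  -- The kernel is `k_l - conj (u l) u k_l`. Against `u h` both terms give `conj (u l * h l)`: the
  -- first by the reproducing property of `k_l`, the second after cancelling the inner factor `u`.
  have hmem : szegoCoeff l - star (u l) • b ∈ modelSubmodule u := by
    rw [mem_modelSubmodule]
    intro h hh G hG
    obtain ⟨c, hc⟩ := exists_powerSum_of_mem_H2 hh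
    obtain ⟨g, hg⟩ := exists_powerSum_of_mem_H2 (hu.mul_mem_H2 hh)
    rw [(isBoundaryFunction_iff_eq hg G).mp hG, LinearIsometry.inner_map_map, inner_sub_right,
      inner_smul_right, hu.inner_of_eq_mul (c := c) (d := szegoCoeff l)
        (fun z hz => by rw [← hg z hz, hc z hz]) (fun z hz => (hb z hz).symm)
        (fun z hz => norm_powerSum_szegoCoeff_le l hz),
      ← inner_conj_symm, inner_szegoCoeff, ← inner_conj_symm c, inner_szegoCoeff,
      ← hg _ (coe_mem_disk l), ← hc _ (coe_mem_disk l), map_mul]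
    simp
  refine ⟨⟨_, hmem⟩, fun z hz => ?_, fun a => ?_⟩
  · have h1 : HasSum (fun n => (szegoCoeff l - star (u l) • b : CoeffSpace) n * z ^ n)
        (powerSum (szegoCoeff l) z - star (u l) * powerSum b z) := by
      convert! (hasSum_powerSum (szegoCoeff l) hz).sub
        ((hasSum_powerSum b hz).mul_left (star (u l))) using 2 with n
      simp only [lp.coeFn_sub, lp.coeFn_smul, Pi.sub_apply, Pi.smul_apply, smul_eq_mul]
      ring
    rw [powerSum, h1.tsum_eq, ← hb z hz, powerSum_szegoCoeff l hz]
    ring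
  · have h2 : inner ℂ b (a : CoeffSpace) = 0 := by
      rw [← boundaryMap.inner_map_map]
      exact mem_modelSubmodule.mp a.2 _ hkH _ hbB
    rw [Submodule.coe_inner, inner_sub_left, inner_smul_left, h2, inner_szegoCoeff, mul_zero,
      sub_zero]

/-- The reproducing kernel of the model space of an inner function at a point of the disk. -/
def IsInner.kernel (hu : IsInner u) (l : Complex.UnitDisc) : modelSubmodule u :=
  (hu.exists_kernel l).choose

theorem IsInner.inner_kernel (hu : IsInner u) (l : Complex.UnitDisc) (a : modelSubmodule u) :
    inner ℂ (hu.kernel l) a = powerSum (a : CoeffSpace) l :=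
  (hu.exists_kernel l).choose_spec.2 a

theorem IsInner.inner_kernel_kernel (hu : IsInner u) (l w : Complex.UnitDisc) :
    inner ℂ (hu.kernel l) (hu.kernel w) =
      (1 - star (u w) * u l) / (1 - star (w : ℂ) * l) := by
  rw [hu.inner_kernel]
  exact (hu.exists_kernel w).choose_spec.1 l (coe_mem_disk l)

end Inner

/-! ### Clark measures -/

section Clark

variable {u : ℂ → ℂ}

/-- By the maximum modulus principle, the value `1` at one interior point would force `u` to be
identically `1`. This justifies every division by `1 - u`. -/
theorem IsInner.ne_one (hu : IsInner u) (hu1 : ∃ z ∈ disk, u z ≠ 1) {z : ℂ} (hz : z ∈ disk) :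
    u z ≠ 1 := by
  intro h
  obtain ⟨w, hw, hw1⟩ := hu1
  have hmax : IsMaxOn (norm ∘ u) disk z := fun y hy => by
    simpa [h] using hu.norm_le_one y hy
  have := Complex.eqOn_of_isPreconnected_of_isMaxOn_norm (convex_ball 0 1).isPreconnected
    Metric.isOpen_ball hu.differentiableOn hz hmax hw
  exact hw1 (this.trans h)

theorem re_one_add_div_one_sub (w : ℂ) :
    ((1 + w) / (1 - w)).re = (1 - ‖w‖ ^ 2) / ‖1 - w‖ ^ 2 := by
  have := congrFun (poissonKernel_eq_re_herglotzRieszKernel (c := 0) (w := w)) 1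
  simpa [poissonKernel, herglotzRieszKernel] using this.symm

theorem coe_sub_ne_zero (ξ : Circle) {z : ℂ} (hz : z ∈ disk) : (ξ : ℂ) - z ≠ 0 := by
  intro h
  have h1 : ‖z‖ < 1 := by simpa using hz
  rw [← sub_eq_zero.mp h, Circle.norm_coe] at h1
  exact lt_irrefl _ h1

/-- The Poisson kernel is the real part of the Herglotz kernel. -/
theorem re_herglotz (ξ : Circle) (z : ℂ) :
    (((ξ : ℂ) + z) / (ξ - z)).re = (1 - ‖z‖ ^ 2) / ‖z - ξ‖ ^ 2 := by
  have := congrFun (poissonKernel_eq_re_herglotzRieszKernel (c := 0) (w := z)) ξ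
  rw [norm_sub_rev]
  simpa [poissonKernel, herglotzRieszKernel, Circle.norm_coe] using this.symm

theorem continuous_herglotz {z : ℂ} (hz : z ∈ disk) :
    Continuous fun ξ : Circle => ((ξ : ℂ) + z) / (ξ - z) :=
  Continuous.div (by fun_prop) (by fun_prop) fun ξ => coe_sub_ne_zero ξ hz

theorem continuous_poisson {z : ℂ} (hz : z ∈ disk) :
    Continuous fun ξ : Circle => (1 - ‖z‖ ^ 2) / ‖z - ξ‖ ^ 2 := by
  simp only [← re_herglotz]
  exact Complex.continuous_re.comp (continuous_herglotz hz)

/-- The function `w ↦ f (r w)` is holomorphic across the closed disk, so the Poisson formula applies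
to it; then take real parts. -/
theorem integral_poisson_mul_re {f : ℂ → ℂ} (hf : DifferentiableOn ℂ f disk) {r : ℝ}
    (h0 : 0 ≤ r) (h1 : r < 1) {z : ℂ} (hz : z ∈ disk) :
    ∫ ξ : Circle, (f (r * ξ)).re * ((1 - ‖z‖ ^ 2) / ‖z - ξ‖ ^ 2) ∂m = (f (r * z)).re := by
  have hd : DiffContOnCl ℂ (fun w => f (r * w)) (Metric.ball 0 1) := by
    refine DifferentiableOn.diffContOnCl ?_
    rw [closure_ball _ one_ne_zero]
    refine hf.comp (by fun_prop) fun w hw => ?_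
    have hw : ‖w‖ ≤ 1 := by simpa using hw
    simp only [Metric.mem_ball, dist_zero_right, norm_mul, Complex.norm_real,
      Real.norm_of_nonneg h0]
    exact (mul_le_of_le_one_right h0 hw).trans_lt h1
  have hP := hd.circleAverage_poissonKernel_smul hz
  have hk : ∀ ξ : Circle, poissonKernel 0 z ξ = (1 - ‖z‖ ^ 2) / ‖z - ξ‖ ^ 2 := fun ξ => by
    rw [norm_sub_rev]
    simp [poissonKernel, Circle.norm_coe]
  have hcont : Continuous fun ξ : Circle => (poissonKernel 0 z • fun w => f (r * w)) (ξ : ℂ) := by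
    simp only [Pi.smul_apply', hk]
    exact (continuous_poisson hz).smul (continuous_dilate hf.continuousOn h0 h1)
  rw [← integral_m_eq_circleAverage hcont] at hP
  have hint := hcont.integrable_of_hasCompactSupport (μ := m) (HasCompactSupport.of_compactSpace _)
  rw [← hP, ← Complex.reCLM_apply, ← Complex.reCLM.integral_comp_comm hint]
  refine integral_congr_ae (Eventually.of_forall fun ξ => ?_)
  simp only [Pi.smul_apply', Complex.reCLM_apply, Complex.smul_re, smul_eq_mul, hk, mul_comm]

theorem IsInner.re_herglotz_nonneg (hu : IsInner u) {z : ℂ} (hz : z ∈ disk) :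
    0 ≤ ((1 + u z) / (1 - u z)).re := by
  rw [re_one_add_div_one_sub]
  have := hu.norm_le_one z hz
  have := norm_nonneg (u z)
  have : 0 ≤ 1 - ‖u z‖ ^ 2 := by nlinarith
  positivity

theorem IsInner.differentiableOn_herglotz (hu : IsInner u) (hu1 : ∃ z ∈ disk, u z ≠ 1) :
    DifferentiableOn ℂ (fun z => (1 + u z) / (1 - u z)) disk :=
  ((differentiableOn_const 1).add hu.differentiableOn).div
    ((differentiableOn_const 1).sub hu.differentiableOn)
    fun _ hz => sub_ne_zero.mpr (hu.ne_one hu1 hz).symm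

/-- A holomorphic function with nonnegative real part is, up to an imaginary constant, the
Herglotz integral of a finite measure. -/
theorem exists_measure_poisson_eq_re {f : ℂ → ℂ} (hf : DifferentiableOn ℂ f disk)
    (hpos : ∀ z ∈ disk, 0 ≤ (f z).re) :
    ∃ σ : FiniteMeasure Circle, ∀ z ∈ disk,
      (f z).re = ∫ ξ : Circle, (1 - ‖z‖ ^ 2) / ‖z - ξ‖ ^ 2 ∂(σ : Measure Circle) := by
  have hcont : ∀ r : ℝ, 0 ≤ r → r < 1 → Continuous fun ξ : Circle => (f (r * ξ)).re :=
    fun r h0 h1 => Complex.continuous_re.comp (continuous_dilate hf.continuousOn h0 h1)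
  have hint : ∀ r : ℝ, 0 ≤ r → r < 1 → Integrable (fun ξ : Circle => (f (r * ξ)).re) m :=
    fun r h0 h1 => (hcont r h0 h1).integrable_of_hasCompactSupport
      (HasCompactSupport.of_compactSpace _)
  have hfin : ∀ r : ℝ, 0 ≤ r → r < 1 →
      IsFiniteMeasure (m.withDensity fun ξ : Circle => ENNReal.ofReal (f (r * ξ)).re) :=
    fun r h0 h1 => isFiniteMeasure_withDensity_ofReal (hint r h0 h1).2
  have hex : ∀ r : ℝ, ∃ ν : FiniteMeasure Circle, 0 ≤ r → r < 1 → ∀ g : Circle → ℝ,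
      ∫ ξ, g ξ ∂(ν : Measure Circle) = ∫ ξ : Circle, (f (r * ξ)).re * g ξ ∂m := by
    intro r
    by_cases h : 0 ≤ r ∧ r < 1
    · have := hfin r h.1 h.2
      refine ⟨⟨_, this⟩, fun h0 h1 g => ?_⟩
      simp only [FiniteMeasure.toMeasure_mk]
      rw [integral_withDensity_eq_integral_toReal_smul
        (hcont r h0 h1).measurable.ennreal_ofReal (by simp)]
      refine integral_congr_ae (Eventually.of_forall fun ξ => ?_)
      simp [ENNReal.toReal_ofReal (hpos _ (mul_mem_disk h0 h1 ξ))]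
    · exact ⟨0, fun h0 h1 => absurd ⟨h0, h1⟩ h⟩
  choose ν hν using hex
  have hPoisson : ∀ r : ℝ, 0 ≤ r → r < 1 → ∀ z ∈ disk,
      ∫ ξ : Circle, (1 - ‖z‖ ^ 2) / ‖z - ξ‖ ^ 2 ∂(ν r : Measure Circle) = (f (r * z)).re :=
    fun r h0 h1 z hz => by
      rw [hν r h0 h1, integral_poisson_mul_re hf h0 h1 hz]
  -- The Poisson kernel at `0` is identically `1`, so all the measures `Re f(rξ) dm` have mass `Re
  -- f(0)`.
  have hmass : ∀ᶠ r in 𝓝[<] (1 : ℝ),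
      ν r ∈ {μ : FiniteMeasure Circle | μ.mass ≤ (f 0).re.toNNReal} := by
    filter_upwards [eventually_mem_Ico] with r hr
    have := hPoisson r hr.1 hr.2 0 (by simp)
    simp only [norm_zero, zero_sub, norm_neg, Circle.norm_coe, mul_zero, one_pow, ne_eq,
      OfNat.ofNat_ne_zero, not_false_eq_true, zero_pow, sub_zero, div_one, integral_const,
      smul_eq_mul, mul_one] at this
    rw [← this]
    refine NNReal.le_toNNReal_of_coe_le (le_of_eq rfl)
  -- Weak compactness of measures of bounded mass gives a cluster point as `r → 1`. It suffices,
  -- since the Poisson integrals converge to `Re f(z)` along the whole filter.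
  obtain ⟨σ, -, hσ⟩ := (isCompact_setOfPred_finiteMeasure_le_of_compactSpace Circle
    (f 0).re.toNNReal).exists_mapClusterPt (f := 𝓝[<] (1 : ℝ)) (u := ν)
      (tendsto_principal.mpr hmass)
  refine ⟨σ, fun z hz => ?_⟩
  let P : BoundedContinuousFunction Circle ℝ :=
    BoundedContinuousFunction.mkOfCompact ⟨_, continuous_poisson hz⟩
  have hΦ : Continuous fun μ : FiniteMeasure Circle => ∫ ξ, P ξ ∂(μ : Measure Circle) :=
    FiniteMeasure.continuous_integral_boundedContinuousFunction P
  have h1 := hσ.continuousAt_comp hΦ.continuousAt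
  have h2 : Tendsto (fun r : ℝ => ∫ ξ, P ξ ∂(ν r : Measure Circle)) (𝓝[<] 1) (𝓝 (f z).re) := by
    have hlim : Tendsto (fun r : ℝ => (f (r * z)).re) (𝓝[<] 1) (𝓝 (f z).re) := by
      have hfz : ContinuousAt (fun r : ℝ => (f (r * z)).re) 1 := by
        refine Complex.continuous_re.continuousAt.comp ?_
        refine ContinuousAt.comp (f := fun r : ℝ => (r : ℂ) * z) (g := f) ?_ (by fun_prop)
        simpa using hf.continuousOn.continuousAt (Metric.isOpen_ball.mem_nhds hz)
      simpa using hfz.tendsto.mono_left nhdsWithin_le_nhds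
    refine hlim.congr' ?_
    filter_upwards [eventually_mem_Ico] with r hr
    exact (hPoisson r hr.1 hr.2 z hz).symm
  have h3 : NeBot (𝓝 (∫ ξ, P ξ ∂(σ : Measure Circle)) ⊓ 𝓝 (f z).re) :=
    NeBot.mono h1 (inf_le_inf_left _ h2)
  exact (eq_of_nhds_neBot h3).symm

theorem IsInner.isClarkMeasure (hu : IsInner u) (hu1 : ∃ z ∈ disk, u z ≠ 1) :
    IsClarkMeasure u (clarkMeasure u) := by
  have h : ∃ σ : Measure Circle, IsClarkMeasure u σ := by
    obtain ⟨σ, hσ⟩ := exists_measure_poisson_eq_re (hu.differentiableOn_herglotz hu1)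
      fun z hz => hu.re_herglotz_nonneg hz
    exact ⟨σ, inferInstance, fun z hz => by rw [← hσ z hz, re_one_add_div_one_sub]⟩
  rw [clarkMeasure, dif_pos h]
  exact h.choose_spec

theorem differentiableOn_integral_herglotz (σ : Measure Circle) [IsFiniteMeasure σ] :
    DifferentiableOn ℂ (fun z => ∫ ξ : Circle, ((ξ : ℂ) + z) / (ξ - z) ∂σ) disk := by
  intro z₀ hz₀
  have hz1 : ‖z₀‖ < 1 := by simpa using hz₀
  -- Half the distance from `z₀` to the circle: points of the `δ`-ball stay at least `δ` away from
  -- the circle, so the `z`-derivative `2ξ / (ξ - z)²` is bounded by `2 / δ²`.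
  set δ := (1 - ‖z₀‖) / 2 with hδ
  have hδ0 : 0 < δ := by rw [hδ]; linarith
  have hball : ∀ z ∈ Metric.ball z₀ δ, ∀ ξ : Circle, z ∈ disk ∧ δ ≤ ‖(ξ : ℂ) - z‖ := by
    intro z hz ξ
    have h1 : ‖z - z₀‖ < δ := by simpa [dist_eq_norm] using hz
    have h2 : ‖z‖ ≤ ‖z - z₀‖ + ‖z₀‖ := by simpa using norm_add_le (z - z₀) z₀
    have h3 := norm_sub_norm_le (ξ : ℂ) z
    rw [Circle.norm_coe] at h3
    constructor
    · simp only [Metric.mem_ball, dist_zero_right]; linarith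
    · linarith
  have hderiv := hasDerivAt_integral_of_dominated_loc_of_deriv_le (𝕜 := ℂ) (μ := σ)
    (F := fun z (ξ : Circle) => ((ξ : ℂ) + z) / (ξ - z))
    (F' := fun z (ξ : Circle) => 2 * (ξ : ℂ) / (ξ - z) ^ 2) (x₀ := z₀)
    (bound := fun _ => 2 / δ ^ 2) (Metric.ball_mem_nhds z₀ hδ0) ?_ ?_ ?_ ?_ (integrable_const _) ?_
  · exact hderiv.2.differentiableAt.differentiableWithinAt
  · filter_upwards [Metric.isOpen_ball.mem_nhds hz₀] with z hz
    exact (continuous_herglotz hz).aestronglyMeasurable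
  · exact (continuous_herglotz hz₀).integrable_of_hasCompactSupport
      (HasCompactSupport.of_compactSpace _)
  · exact (Continuous.div (by fun_prop) (by fun_prop)
      fun ξ => pow_ne_zero 2 (coe_sub_ne_zero ξ hz₀)).aestronglyMeasurable
  · refine Eventually.of_forall fun ξ z hz => ?_
    rw [norm_div, norm_mul, norm_pow, Circle.norm_coe, mul_one, Complex.norm_ofNat]
    gcongr
    exact (hball z hz ξ).2
  · refine Eventually.of_forall fun ξ z hz => ?_
    have hne := coe_sub_ne_zero ξ (hball z hz ξ).1
    convert! ((hasDerivAt_id z).const_add (ξ : ℂ)).div ((hasDerivAt_id z).const_sub (ξ : ℂ)) hne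
      using 1
    simp only [id]
    ring

/-- The Gram matrix of the Cauchy kernels with respect to the Clark measure. -/
theorem IsInner.inner_cauchyKernelLp (hu : IsInner u) (hu1 : ∃ z ∈ disk, u z ≠ 1)
    (l w : Complex.UnitDisc) :
    inner ℂ (cauchyKernelLp (clarkMeasure u) l) (cauchyKernelLp (clarkMeasure u) w) =
      (1 - star (u w) * u l) / (1 - star (w : ℂ) * l) / ((1 - u l) * (1 - star (u w))) := by
  set σ := clarkMeasure u
  set H : ℂ → ℂ := fun z => (1 + u z) / (1 - u z)
  set C : ℂ → ℂ := fun z => ∫ ξ : Circle, ((ξ : ℂ) + z) / (ξ - z) ∂σ with hC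
  have hint : ∀ z ∈ disk, Integrable (fun ξ : Circle => ((ξ : ℂ) + z) / (ξ - z)) σ :=
    fun z hz => (continuous_herglotz hz).integrable_of_hasCompactSupport
      (HasCompactSupport.of_compactSpace _)
  have hre : ∀ z ∈ disk, ((fun z => H z - C z) z).re = 0 := by
    intro z hz
    have h1 : (H z).re = ∫ ξ : Circle, (1 - ‖z‖ ^ 2) / ‖z - ξ‖ ^ 2 ∂σ := by
      rw [re_one_add_div_one_sub, (hu.isClarkMeasure hu1).2 z hz]
    have h2 : (C z).re = ∫ ξ : Circle, (1 - ‖z‖ ^ 2) / ‖z - ξ‖ ^ 2 ∂σ := by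
      simp only [← re_herglotz]
      exact (Complex.reCLM.integral_comp_comm (hint z hz)).symm
    simp [h1, h2]
  -- The defining property of the Clark measure equates the real parts of `H` and its Herglotz
  -- integral `C`, so they differ by an imaginary constant, which cancels in `C l + conj (C w)`.
  obtain ⟨c, hc⟩ := AnalyticOnNhd.eq_const_of_re_eq_const
    (((hu.differentiableOn_herglotz hu1).sub (differentiableOn_integral_herglotz σ)).analyticOnNhd
      Metric.isOpen_ball) hre Metric.isOpen_ball
    ((convex_ball (0 : ℂ) 1).isConnected ⟨0, by simp⟩)
  have hl := coe_mem_disk l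
  have hw := coe_mem_disk w
  have hcc : c + star c = 0 := by
    have h0 := hre l hl
    have h1 := hc l hl
    simp only [Pi.sub_apply] at h0 h1
    rw [h1] at h0
    rw [Complex.star_def, Complex.add_conj, h0]
    simp
  have hsum : C l + star (C w) = H l + star (H w) := by
    have h1 : H l - C l = c := hc l hl
    have h2 : H w - C w = c := hc w hw
    have h3 : star (H w) - star (C w) = star c := by rw [← star_sub, h2]
    linear_combination -h1 - h3 - hcc
  -- Polarized form of the identity between the Poisson kernel and the real part of the Herglotz
  -- kernel, obtained from `ξ * conj ξ = 1`.
  have hk : ∀ ξ : Circle, (cauchyKernel w ξ) * star (cauchyKernel l ξ) =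
      (2 * (1 - star (w : ℂ) * l))⁻¹ *
        (((ξ : ℂ) + l) / (ξ - l) + star (((ξ : ℂ) + w) / (ξ - w))) := by
    intro ξ
    have hξ : (ξ : ℂ) * star (ξ : ℂ) = 1 := by
      rw [Complex.star_def, Complex.mul_conj, Circle.normSq_coe, Complex.ofReal_one]
    have hξ0 : (ξ : ℂ) ≠ 0 := ξ.coe_ne_zero
    have e1 := coe_sub_ne_zero ξ hl
    have e2 : star (ξ : ℂ) - star (w : ℂ) ≠ 0 := by
      rw [← star_sub]
      exact star_ne_zero.mpr (coe_sub_ne_zero ξ hw)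
    have e3 := one_sub_star_mul_ne_zero w hl
    have k1 : cauchyKernel w ξ = star (ξ : ℂ) / (star (ξ : ℂ) - star (w : ℂ)) := by
      have : star (ξ : ℂ) - star (w : ℂ) = star (ξ : ℂ) * (1 - star (w : ℂ) * ξ) := by
        linear_combination star (w : ℂ) * hξ
      rw [this, div_mul_cancel_left₀ (star_ne_zero.mpr hξ0)]
      rfl
    have k2 : star (cauchyKernel l ξ) = (ξ : ℂ) / (ξ - l) := by
      have : (ξ : ℂ) - l = ξ * (1 - l * star (ξ : ℂ)) := by
        linear_combination (l : ℂ) * hξ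
      rw [this, div_mul_cancel_left₀ hξ0]
      simp [cauchyKernel]
    rw [k1, k2, star_div₀, star_add, star_sub]
    field_simp
    linear_combination (-2 * star (w : ℂ) * l) * hξ
  have h1 : inner ℂ (cauchyKernelLp σ l) (cauchyKernelLp σ w) =
      (2 * (1 - star (w : ℂ) * l))⁻¹ * (C l + star (C w)) := by
    rw [cauchyKernelLp, cauchyKernelLp, ContinuousMap.inner_toLp]
    have hst : star (C w) = ∫ ξ : Circle, star (((ξ : ℂ) + w) / (ξ - w)) ∂σ :=
      integral_conj.symm
    have hint' : Integrable (fun ξ : Circle => star (((ξ : ℂ) + w) / (ξ - w))) σ :=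
      (continuous_herglotz hw).star.integrable_of_hasCompactSupport
        (HasCompactSupport.of_compactSpace _)
    rw [hst, hC, ← integral_add (hint l hl) hint', ← integral_const_mul]
    exact integral_congr_ae (Eventually.of_forall hk)
  rw [h1, hsum]
  have e1 : 1 - u l ≠ 0 := sub_ne_zero.mpr (hu.ne_one hu1 hl).symm
  have e2 : 1 - star (u w) ≠ 0 := by
    have := star_ne_zero.mpr (sub_ne_zero.mpr (hu.ne_one hu1 hw).symm)
    simpa using this
  have e3 := one_sub_star_mul_ne_zero w hl
  simp only [H, star_div₀, star_add, star_sub, star_one]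
  field_simp
  ring

end Clark

/-! ### Multipliers and adjoint operators -/

section Multipliers

variable {u v φ : ℂ → ℂ}

theorem modelSubmodule_inner_smul_left (c : ℂ) (x y : modelSubmodule u) :
    inner ℂ (c • x) y = star c * inner ℂ x y :=
  inner_smul_left x y c

theorem modelSubmodule_inner_smul_right (c : ℂ) (x y : modelSubmodule u) :
    inner ℂ x (c • y) = c * inner ℂ x y :=
  inner_smul_right x y c

/-- Clark's isometry in Gram matrix form. The free weights `s` let it serve both for the source
vectors and for their prescribed images. -/
theorem IsInner.inner_eq_inner_kernel (hu : IsInner u) (hu1 : ∃ z ∈ disk, u z ≠ 1)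
    (s : Complex.UnitDisc → ℂ) (l w : Complex.UnitDisc) :
    inner ℂ (s l • cauchyKernelLp (clarkMeasure u) l) (s w • cauchyKernelLp (clarkMeasure u) w) =
      inner ℂ ((s l / (1 - star (u l))) • hu.kernel l) ((s w / (1 - star (u w))) • hu.kernel w) := by
  rw [inner_smul_left, inner_smul_right, modelSubmodule_inner_smul_left,
    modelSubmodule_inner_smul_right, hu.inner_cauchyKernelLp hu1, hu.inner_kernel_kernel]
  simp only [← Complex.star_def, star_div₀, star_sub, star_one, star_star]
  simp only [div_eq_mul_inv, mul_inv]
  ring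

/-- Multiplication by `φ` maps the model space of `u` into that of `v` exactly when its formal
adjoint, defined on reproducing kernels, is bounded. -/
theorem mem_multipliers_iff_exists_adjoint (hu : IsInner u) (hv : IsInner v)
    (hφ : DifferentiableOn ℂ φ disk) :
    φ ∈ multipliers u v ↔ ∃ T : modelSubmodule v →L[ℂ] modelSubmodule u,
      ∀ l : Complex.UnitDisc, T (hv.kernel l) = star (φ l) • hu.kernel l := by
  constructor
  · rintro ⟨-, hmul⟩
    have hex : ∀ a : modelSubmodule u, ∃ b : modelSubmodule v,
        ∀ l : Complex.UnitDisc, inner ℂ (hv.kernel l) b = φ l * inner ℂ (hu.kernel l) a := by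
      intro a
      obtain ⟨b, hb, h⟩ := mem_modelSpace_iff.mp
        (hmul _ (mem_modelSpace_iff.mpr ⟨a, a.2, fun _ _ => rfl⟩))
      refine ⟨⟨b, hb⟩, fun l => ?_⟩
      rw [hv.inner_kernel, hu.inner_kernel]
      exact (h l (coe_mem_disk l)).symm
    have huniq : ∀ b b' : modelSubmodule v,
        (∀ l, inner ℂ (hv.kernel l) b = inner ℂ (hv.kernel l) b') → b = b' := by
      intro b b' h
      refine Subtype.ext (eq_of_powerSum_eq fun z hz => ?_)
      have := h (Complex.UnitDisc.mk z (by simpa using hz))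
      rwa [hv.inner_kernel, hv.inner_kernel] at this
    choose M hM using hex
    let M' : modelSubmodule u →ₗ[ℂ] modelSubmodule v :=
      { toFun := M
        map_add' := fun a a' => huniq _ _ fun l => by
          rw [hM, inner_add_right, inner_add_right, hM, hM, mul_add]
        map_smul' := fun c a => huniq _ _ fun l => by
          rw [hM, inner_smul_right, RingHom.id_apply, inner_smul_right, hM]
          ring }
    have hcont : Continuous M' := by
      -- The graph is closed because pairing with a kernel is continuous and the kernels separate
      -- points of `K_v`.
      refine M'.continuous_of_seq_closed_graph fun x a b hx hMx => huniq _ _ fun l => ?_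
      have h1 := (tendsto_const_nhds (x := hv.kernel l)).inner (𝕜 := ℂ) hMx
      have h2 := ((tendsto_const_nhds (x := hu.kernel l)).inner (𝕜 := ℂ) hx).const_mul (φ l)
      refine (tendsto_nhds_unique h1 (h2.congr fun n => ?_)).trans (hM a l).symm
      exact (hM (x n) l).symm
    let T : modelSubmodule u →L[ℂ] modelSubmodule v := ⟨M', hcont⟩
    refine ⟨ContinuousLinearMap.adjoint T, fun l => ext_inner_right ℂ fun a => ?_⟩
    rw [ContinuousLinearMap.adjoint_inner_left, modelSubmodule_inner_smul_left, star_star]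
    exact hM a l
  · rintro ⟨T, hT⟩
    refine ⟨hφ, fun f hf => ?_⟩
    obtain ⟨a, ha, hfa⟩ := mem_modelSpace_iff.mp hf
    refine mem_modelSpace_iff.mpr
      ⟨ContinuousLinearMap.adjoint T ⟨a, ha⟩, Subtype.property _, fun z hz => ?_⟩
    -- Evaluating `T* a` at `z` is pairing with `K^v_z`; moving `T` to the kernel turns this into `φ
    -- z * f z`.
    have hl := hv.inner_kernel (Complex.UnitDisc.mk z (by simpa using hz))
      (ContinuousLinearMap.adjoint T ⟨a, ha⟩)
    rw [ContinuousLinearMap.adjoint_inner_right, hT, modelSubmodule_inner_smul_left, star_star,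
      hu.inner_kernel] at hl
    simpa [hfa z hz] using hl

end Multipliers

end ModelSpace

end

theorem theorem7p2 (u v φ : ℂ → ℂ)
    (hu : ModelSpace.IsInner u) (hv : ModelSpace.IsInner v)
    (hu1 : ∃ z ∈ ModelSpace.disk, u z ≠ 1) (hv1 : ∃ z ∈ ModelSpace.disk, v z ≠ 1)
    (hφ : φ ∈ ModelSpace.H2) :
    φ ∈ ModelSpace.multipliers u v ↔
      ∃ L : Lp ℂ 2 (ModelSpace.clarkMeasure v) →L[ℂ] Lp ℂ 2 (ModelSpace.clarkMeasure u),
        ∀ l : Complex.UnitDisc,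
          L (ModelSpace.cauchyKernelLp (ModelSpace.clarkMeasure v) l) =
            (star (φ l) * ((1 - star (u l)) / (1 - star (v l)))) •
              ModelSpace.cauchyKernelLp (ModelSpace.clarkMeasure u) l := by
  rw [ModelSpace.mem_multipliers_iff_exists_adjoint hu hv hφ.1]
  have ne : ∀ {w : ℂ → ℂ}, ModelSpace.IsInner w → (∃ z ∈ ModelSpace.disk, w z ≠ 1) →
      ∀ l : Complex.UnitDisc, 1 - star (w l) ≠ 0 := fun hw hw1 l => by
    simpa using star_ne_zero.mpr
      (sub_ne_zero.mpr (hw.ne_one hw1 (ModelSpace.coe_mem_disk l)).symm)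
  have gv := fun l w => hv.inner_eq_inner_kernel hv1 (fun _ => 1) l w
  have gu := fun l w => hu.inner_eq_inner_kernel hu1
    (fun l => star (φ l) * ((1 - star (u l)) / (1 - star (v l)))) l w
  simp only [one_smul] at gv
  -- After Clark's normalization of the target, the factor `1 - conj (u l)` cancels. What remains is
  -- the factor by which `T` sends `K^v_l / (1 - conj (v l))` to a multiple of `K^u_l`.
  have hs : ∀ l : Complex.UnitDisc,
      star (φ l) * ((1 - star (u l)) / (1 - star (v l))) / (1 - star (u l)) =
        1 / (1 - star (v l)) * star (φ l) := fun l => by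
    have h1 := ne hu hu1 l
    have h2 := ne hv hv1 l
    field_simp
  constructor
  · rintro ⟨T, hT⟩
    refine ModelSpace.exists_clm_of_inner_eq (fun l w => (gv l w).symm)
      (fun l w => (gu l w).symm) ⟨T, fun l => ?_⟩
    rw [map_smul, hT, smul_smul, hs]
  · intro hL
    obtain ⟨T, hT⟩ := ModelSpace.exists_clm_of_inner_eq gv gu hL
    refine ⟨T, fun l => ?_⟩
    have := hT l
    rw [map_smul, hs, mul_smul] at this
    exact smul_right_injective _ (one_div_ne_zero (ne hv hv1 l)) this
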